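/- Let $X$ be a real inner product space with $\dim X\ge 2$, let $Y$ be a real sequentially complete topological vector space, and let $r,s,t$ be positive integers. Let $B\subseteq X$ be an open ball containing $0$ and let $f:B\to Y$ satisfy $f(0)=0$. Suppose that $f$ is orthogonally generalized Jensen on $B$, that is, $$r\,f\!\left(\frac{sx+ty}{r}\right)=s\,f(x)+t\,f(y)$$ for all $x,y\in B$ with $\langle x,y\rangle=0$ and $\frac{sx+ty}{r}\in B$. Then there exist additive mappings $T:X\to Y$ and $b:[0,\infty)\to Y$ such that $$f(x)=T(x)+b\left(\|x\|^2\right)\qquad\text{for all }x\in B.$$ -/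

import Mathlib

open scoped NNReal Topology

/-- Sequential completeness of a topological vector space (or topological abelian group):
every Cauchy sequence converges. -/
def IsSequentiallyComplete (Y : Type*) [AddCommGroup Y] [TopologicalSpace Y] : Prop :=
  ∀ u : ℕ → Y,
    (∀ U ∈ 𝓝 (0 : Y), ∃ N : ℕ, ∀ m n : ℕ, N ≤ m → N ≤ n → u m - u n ∈ U) →
      ∃ y : Y, Filter.Tendsto u Filter.atTop (𝓝 y)

/-- `f : B → Y` is orthogonally generalized Jensen with parameters `r, s, t`:
`r f ((s x + t y) / r) = s f x + t f y` for all orthogonal `x, y ∈ B` for which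
`z = (s x + t y) / r` lies in the domain `B`. -/
def IsOrthogonallyGeneralizedJensen {X Y : Type*} [NormedAddCommGroup X] [InnerProductSpace ℝ X]
    [AddCommGroup Y] [Module ℝ Y] (r s t : ℕ) (B : Set X) (f : B → Y) : Prop :=
  ∀ x y z : B, inner ℝ (x : X) (y : X) = 0 →
    (z : X) = (r : ℝ)⁻¹ • ((s : ℝ) • (x : X) + (t : ℝ) • (y : X)) →
      (r : ℝ) • f z = (s : ℝ) • f x + (t : ℝ) • f y

/-!
An orthogonally additive map `F` on the whole space is the sum of its odd part, which is additive,
and of its even part, which only depends on `‖x‖ ^ 2` and is additive in it by Pythagoras' theorem.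

If `F` is orthogonally additive on a ball only, decomposing `2 x` as `(x + w) + (x - w)` with
`w ⟂ x` and `‖w‖ = ‖x‖` gives `F (2 x) = 3 F x + F (-x)`. The right-hand side extends `F` to the
ball of twice the radius, hence, by iteration, to the whole space. An orthogonally additive map that
vanishes near `0` vanishes on every star-shaped open set around `0`: up to values near `0`,
projecting `x` to a nearby line and back does not change its image, but shrinks `x` by a constant
factor.

A Jensen map with `f 0 = 0` satisfies `r f (s x / r) = s f x` and its analogue for `t`, and is
therefore orthogonally additive near `0`. If `r = s = t`, it is orthogonally additive on all of the
ball. Otherwise, say for `s ≠ r`, the scaling relation is incompatible with a nonzero quadratic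
part, so `f` is additive near `0`, and the same relation propagates this to the ball.
-/

open Filter Function Metric Set
open scoped RealInnerProductSpace

section Auxiliary

theorem map_add_of_odd_of_nonneg {A Y : Type*} [AddCommGroup A] [LinearOrder A]
    [IsOrderedAddMonoid A] [AddCommGroup Y] {g : A → Y} (hodd : ∀ a, g (-a) = -g a)
    (hadd : ∀ a b, 0 ≤ a → 0 ≤ b → g (a + b) = g a + g b) (a b : A) : g (a + b) = g a + g b := by
  have map_sub : ∀ a b, 0 ≤ a → 0 ≤ b → g (a - b) = g a - g b := by
    intro a b ha hb
    rcases le_total b a with h | h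
    · rw [eq_sub_iff_add_eq, ← hadd _ _ (sub_nonneg.2 h) hb, sub_add_cancel]
    · rw [← neg_sub b a, hodd, ← neg_sub (g b), neg_inj, eq_sub_iff_add_eq,
        ← hadd _ _ (sub_nonneg.2 h) ha, sub_add_cancel]
  rcases le_total 0 a with ha | ha <;> rcases le_total 0 b with hb | hb
  · exact hadd a b ha hb
  · simpa [hodd] using map_sub a (-b) ha (neg_nonneg.2 hb)
  · simpa [hodd, add_comm] using map_sub b (-a) hb (neg_nonneg.2 ha)
  · have h := hadd (-b) (-a) (neg_nonneg.2 hb) (neg_nonneg.2 ha)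
    rwa [← neg_add_rev, hodd, hodd, hodd, ← neg_add_rev, neg_inj] at h

theorem exists_forall_eqOn_of_eqOn_succ {α β : Type*} {S : ℕ → Set α} (hmono : Monotone S)
    (hcover : ∀ x, ∃ n, x ∈ S n) {F : ℕ → α → β} (hF : ∀ n, EqOn (F (n + 1)) (F n) (S n)) :
    ∃ G : α → β, ∀ n, EqOn G (F n) (S n) := by
  have eqOn_of_le : ∀ m n, m ≤ n → EqOn (F n) (F m) (S m) := by
    intro m n hmn
    induction n, hmn using Nat.le_induction with
    | base => exact eqOn_refl _ _
    | succ n hmn ih => exact ((hF n).mono (hmono hmn)).trans ih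
  choose N hN using hcover
  refine ⟨fun x => F (N x) x, fun n x hx => ?_⟩
  rcases le_total (N x) n with h | h
  · exact (eqOn_of_le _ _ h (hN x)).symm
  · exact eqOn_of_le _ _ h hx

theorem of_eventually_nhds_zero_of_smul {E : Type*} [AddCommGroup E] [Module ℝ E]
    [TopologicalSpace E] [ContinuousSMul ℝ E] {P : E → Prop} {a : ℝ} (ha₀ : 0 ≤ a) (ha₁ : a < 1)
    (hP : ∀ᶠ y in 𝓝 0, P y) {x : E} (hstep : ∀ n : ℕ, P (a ^ (n + 1) • x) → P (a ^ n • x)) :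
    P x := by
  have descend : ∀ n : ℕ, P (a ^ n • x) → P x := by
    intro n
    induction n with
    | zero => simp
    | succ n ih => exact fun h => ih (hstep n h)
  have tendsto_zero : Tendsto (fun n : ℕ => a ^ n • x) atTop (𝓝 0) := by
    simpa using (tendsto_pow_atTop_nhds_zero_of_lt_one ha₀ ha₁).smul_const x
  obtain ⟨n, hn⟩ := (tendsto_zero.eventually hP).exists
  exact descend n hn

theorem exists_pos_add_smul_mem {E : Type*} [AddCommGroup E] [Module ℝ E] [TopologicalSpace E]
    [IsTopologicalAddGroup E] [ContinuousSMul ℝ E] (x w : E) {S U : Set E} (hS : S ∈ 𝓝 x)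
    (hU : U ∈ 𝓝 0) :
    ∃ θ : ℝ, 0 < θ ∧ x + θ • w ∈ S ∧ θ • w ∈ U ∧ θ • (θ • x - w) ∈ U := by
  have near_zero : ∀ {φ : ℝ → E} {V : Set E}, Continuous φ → V ∈ 𝓝 (φ 0) →
      ∀ᶠ θ in 𝓝[>] (0 : ℝ), φ θ ∈ V := fun hφ hV =>
    ((hφ.tendsto 0).eventually hV).filter_mono nhdsWithin_le_nhds
  have hadd := near_zero (φ := fun θ => x + θ • w) (by fun_prop) (by simpa using hS)
  have hw := near_zero (φ := fun θ => θ • w) (by fun_prop) (by simpa using hU)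
  have hsub := near_zero (φ := fun θ => θ • (θ • x - w)) (by fun_prop) (by simpa using hU)
  exact (eventually_mem_nhdsWithin.and (hadd.and (hw.and hsub))).exists

theorem nsmul_natCast_div_smul {E : Type*} [AddCommGroup E] [Module ℝ E] (m : ℕ) {n : ℕ}
    (hn : 0 < n) (x : E) : n • ((m : ℝ) / n) • x = m • x := by
  have hn' : (n : ℝ) ≠ 0 := by positivity
  rw [← Nat.cast_smul_eq_nsmul ℝ n, smul_smul, mul_div_cancel₀ _ hn', Nat.cast_smul_eq_nsmul]

end Auxiliary

section InnerProductSpace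

variable {X : Type*} [NormedAddCommGroup X] [InnerProductSpace ℝ X]

theorem exists_inner_eq_zero_norm_eq (hdim : 2 ≤ Module.rank ℝ X) (x : X) {a : ℝ} (ha : 0 ≤ a) :
    ∃ w : X, ⟪x, w⟫ = 0 ∧ ‖w‖ = a := by
  have span_orthogonal_ne_bot : (ℝ ∙ x)ᗮ ≠ ⊥ := by
    rw [Ne, Submodule.orthogonal_eq_bot_iff]
    intro htop
    have hrank : Module.rank ℝ (ℝ ∙ x) ≤ 1 := by simpa using rank_span_le (R := ℝ) ({x} : Set X)
    rw [htop, rank_top] at hrank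
    exact absurd (hdim.trans hrank) (by norm_num)
  obtain ⟨w, hw, hw0⟩ := Submodule.exists_mem_ne_zero_of_ne_bot span_orthogonal_ne_bot
  refine ⟨(a / ‖w‖) • w, ?_, ?_⟩
  · rw [inner_smul_right, Submodule.mem_orthogonal_singleton_iff_inner_right.1 hw, mul_zero]
  · rw [norm_smul, Real.norm_of_nonneg (by positivity), div_mul_cancel₀ _ (norm_ne_zero_iff.2 hw0)]

theorem norm_left_le_norm_add_of_inner_eq_zero {x y : X} (h : ⟪x, y⟫ = 0) : ‖x‖ ≤ ‖x + y‖ := by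
  have pythagoras := norm_add_sq_eq_norm_sq_add_norm_sq_real h
  nlinarith [norm_nonneg (x + y), mul_self_nonneg ‖y‖]

theorem norm_right_le_norm_add_of_inner_eq_zero {x y : X} (h : ⟪x, y⟫ = 0) : ‖y‖ ≤ ‖x + y‖ := by
  rw [real_inner_comm] at h
  rw [add_comm]
  exact norm_left_le_norm_add_of_inner_eq_zero h

end InnerProductSpace

/-- `F` is additive on orthogonal pairs in `S` whose sum is in `S`; its values outside `S` are
irrelevant. -/
def OrthogonallyAdditiveOn {X Y : Type*} [NormedAddCommGroup X] [InnerProductSpace ℝ X]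
    [AddCommGroup Y] (F : X → Y) (S : Set X) : Prop :=
  ∀ ⦃x⦄, x ∈ S → ∀ ⦃y⦄, y ∈ S → x + y ∈ S → ⟪x, y⟫ = 0 → F (x + y) = F x + F y

/-- `F` is additive on orthogonal pairs of the whole space. -/
def OrthogonallyAdditive {X Y : Type*} [NormedAddCommGroup X] [InnerProductSpace ℝ X]
    [AddCommGroup Y] (F : X → Y) : Prop :=
  ∀ ⦃x y⦄, ⟪x, y⟫ = 0 → F (x + y) = F x + F y

section OrthogonallyAdditive

variable {X Y : Type*} [NormedAddCommGroup X] [InnerProductSpace ℝ X] [AddCommGroup Y]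

namespace OrthogonallyAdditive

variable {F : X → Y}

theorem orthogonallyAdditiveOn (hF : OrthogonallyAdditive F) (S : Set X) :
    OrthogonallyAdditiveOn F S :=
  fun _ _ _ _ _ hxy => hF hxy

theorem sub {G : X → Y} (hF : OrthogonallyAdditive F) (hG : OrthogonallyAdditive G) :
    OrthogonallyAdditive (F - G) := by
  intro x y hxy
  simp only [Pi.sub_apply, hF hxy, hG hxy]
  abel

theorem comp_neg (hF : OrthogonallyAdditive F) : OrthogonallyAdditive fun x => F (-x) := by
  intro x y hxy
  simp only [neg_add]
  exact hF (by rwa [inner_neg_neg])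

theorem map_add_smul_of_odd (hdim : 2 ≤ Module.rank ℝ X) (hF : OrthogonallyAdditive F)
    (hodd : ∀ x, F (-x) = -F x) (v : X) (a b : ℝ) : F ((a + b) • v) = F (a • v) + F (b • v) := by
  refine map_add_of_odd_of_nonneg (g := fun c : ℝ => F (c • v))
    (fun c => by rw [neg_smul, hodd]) (fun a b ha hb => ?_) a b
  obtain ⟨w, hvw, hw⟩ := exists_inner_eq_zero_norm_eq hdim v (a := √(a * b) * ‖v‖) (by positivity)
  have hwv : ⟪w, v⟫ = 0 := by rw [real_inner_comm, hvw]
  -- The length of `w` makes these two summands of `(a + b) • v` orthogonal.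
  have horth : ⟪a • v + w, b • v + -w⟫ = 0 := by
    simp only [inner_add_left, inner_add_right, inner_neg_right, real_inner_smul_left,
      real_inner_smul_right, hvw, hwv, real_inner_self_eq_norm_sq, hw, mul_pow,
      Real.sq_sqrt (mul_nonneg ha hb)]
    ring
  calc F ((a + b) • v) = F ((a • v + w) + (b • v + -w)) := by congr 1; module
    _ = (F (a • v) + F w) + (F (b • v) + F (-w)) := by
      rw [hF horth, hF (by rw [real_inner_smul_left, hvw, mul_zero]),
        hF (by rw [inner_neg_right, real_inner_smul_left, hvw, mul_zero, neg_zero])]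
    _ = F (a • v) + F (b • v) := by rw [hodd]; abel

theorem map_add_of_odd (hdim : 2 ≤ Module.rank ℝ X) (hF : OrthogonallyAdditive F)
    (hodd : ∀ x, F (-x) = -F x) (x y : X) : F (x + y) = F x + F y := by
  obtain ⟨l, z, hxz, rfl⟩ : ∃ (l : ℝ) (z : X), ⟪x, z⟫ = 0 ∧ y = l • x + z := by
    obtain ⟨p, hp, z, hz, rfl⟩ := (ℝ ∙ x).exists_add_mem_mem_orthogonal y
    obtain ⟨l, rfl⟩ := Submodule.mem_span_singleton.1 hp
    exact ⟨l, z, Submodule.mem_orthogonal_singleton_iff_inner_right.1 hz, rfl⟩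
  have map_smul_add : ∀ c : ℝ, F (c • x + z) = F (c • x) + F z := fun c =>
    hF (by rw [real_inner_smul_left, hxz, mul_zero])
  calc F (x + (l • x + z)) = F ((1 + l) • x + z) := by congr 1; module
    _ = F x + F (l • x + z) := by
      rw [map_smul_add, map_smul_add, hF.map_add_smul_of_odd hdim hodd, one_smul, add_assoc]

theorem eq_of_even_of_norm_eq (hF : OrthogonallyAdditive F) (heven : ∀ x, F (-x) = F x) {x y : X}
    (hxy : ‖x‖ = ‖y‖) : F x = F y := by
  have horth : ⟪(2 : ℝ)⁻¹ • (x + y), (2 : ℝ)⁻¹ • (x - y)⟫ = 0 := by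
    rw [real_inner_smul_left, real_inner_smul_right, (real_inner_add_sub_eq_zero_iff x y).2 hxy,
      mul_zero, mul_zero]
  calc F x = F ((2 : ℝ)⁻¹ • (x + y) + (2 : ℝ)⁻¹ • (x - y)) := by congr 1; module
    _ = F ((2 : ℝ)⁻¹ • (x + y) + -((2 : ℝ)⁻¹ • (x - y))) := by
      rw [hF horth, hF (by rw [inner_neg_right, horth, neg_zero]), heven]
    _ = F y := by congr 1; module

theorem exists_addMonoidHom_of_even (hdim : 2 ≤ Module.rank ℝ X) (hF : OrthogonallyAdditive F)
    (heven : ∀ x, F (-x) = F x) : ∃ b : ℝ≥0 →+ Y, ∀ x, F x = b (‖x‖₊ ^ 2) := by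
  choose v hv using fun q : ℝ≥0 => exists_inner_eq_zero_norm_eq hdim (0 : X) (Real.sqrt_nonneg q)
  have norm_v_sq : ∀ q, ‖v q‖ ^ 2 = q := fun q => by rw [(hv q).2, Real.sq_sqrt q.coe_nonneg]
  have map_eq_of_norm_sq_eq : ∀ {x y}, ‖x‖ ^ 2 = ‖y‖ ^ 2 → F x = F y := fun h =>
    hF.eq_of_even_of_norm_eq heven ((sq_eq_sq₀ (norm_nonneg _) (norm_nonneg _)).1 h)
  have map_zero : F 0 = 0 := by simpa using hF (inner_zero_left (0 : X))
  refine ⟨⟨⟨fun q => F (v q), ?_⟩, fun p q => ?_⟩, fun x => ?_⟩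
  · rw [← map_zero]
    exact map_eq_of_norm_sq_eq (by rw [norm_v_sq]; simp)
  · obtain ⟨w, hw, hw_norm⟩ := exists_inner_eq_zero_norm_eq hdim (v p) (norm_nonneg (v q))
    calc F (v (p + q)) = F (v p + w) := by
          refine map_eq_of_norm_sq_eq ?_
          rw [norm_add_sq_real, hw, hw_norm, norm_v_sq, norm_v_sq, norm_v_sq]
          push_cast
          ring
      _ = F (v p) + F (v q) := by rw [hF hw, hF.eq_of_even_of_norm_eq heven hw_norm]
  · exact map_eq_of_norm_sq_eq (by simp [norm_v_sq])

theorem exists_addMonoidHom (hdim : 2 ≤ Module.rank ℝ X) (hF : OrthogonallyAdditive F) :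
    ∃ (T : X →+ Y) (b : ℝ≥0 →+ Y), ∀ x, F x = T x + b (‖x‖₊ ^ 2) := by
  let D : X →+ Y := AddMonoidHom.mk' (F - fun x => F (-x))
    ((hF.sub hF.comp_neg).map_add_of_odd hdim fun x => by simp)
  -- Halving the argument instead of the value avoids dividing by two in `Y`.
  let T : X →+ Y := D.comp (DistribSMul.toAddMonoidHom X (2 : ℝ)⁻¹)
  have T_add_T : ∀ x, T x + T x = F x - F (-x) := fun x => by
    rw [← map_add]
    change D ((2 : ℝ)⁻¹ • (x + x)) = D x
    congr 1
    module
  have hT : OrthogonallyAdditive T := fun x y _ => map_add T x y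
  obtain ⟨b, hb⟩ := (hF.sub hT).exists_addMonoidHom_of_even hdim fun x => by
    rw [Pi.sub_apply, Pi.sub_apply, map_neg, sub_neg_eq_add, eq_sub_iff_add_eq, add_assoc, T_add_T]
    abel
  exact ⟨T, b, fun x => by rw [← hb, Pi.sub_apply, add_sub_cancel]⟩

end OrthogonallyAdditive

/-- Every orthogonally additive `F` satisfies `F x = halvingExtension F x`; for `F` orthogonally
additive only on a ball around zero, the right-hand side makes sense on the ball of twice the
radius. -/
noncomputable def halvingExtension (F : X → Y) (x : X) : Y :=
  3 • F ((2 : ℝ)⁻¹ • x) + F (-((2 : ℝ)⁻¹ • x))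

namespace OrthogonallyAdditiveOn

variable {F G : X → Y} {S : Set X} {ρ : ℝ}

theorem sub (hF : OrthogonallyAdditiveOn F S) (hG : OrthogonallyAdditiveOn G S) :
    OrthogonallyAdditiveOn (F - G) S := by
  intro x hx y hy hadd hxy
  simp only [Pi.sub_apply, hF hx hy hadd hxy, hG hx hy hadd hxy]
  abel

theorem mono {S' : Set X} (hF : OrthogonallyAdditiveOn F S) (h : S' ⊆ S) :
    OrthogonallyAdditiveOn F S' :=
  fun _ hx _ hy hadd => hF (h hx) (h hy) (h hadd)

theorem map_add_of_norm_lt (hF : OrthogonallyAdditiveOn F (ball 0 ρ)) {x y : X}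
    (hxy : ⟪x, y⟫ = 0) (hρ : ‖x + y‖ < ρ) : F (x + y) = F x + F y := by
  have hx : ‖x‖ < ρ := (norm_left_le_norm_add_of_inner_eq_zero hxy).trans_lt hρ
  have hy : ‖y‖ < ρ := (norm_right_le_norm_add_of_inner_eq_zero hxy).trans_lt hρ
  exact hF (mem_ball_zero_iff.2 hx) (mem_ball_zero_iff.2 hy) (mem_ball_zero_iff.2 hρ) hxy

theorem map_add_map_neg_eq_of_norm_eq (hF : OrthogonallyAdditiveOn F (ball 0 ρ)) {x y : X}
    (hx : ‖x‖ < ρ) (hxy : ‖x‖ = ‖y‖) : F x + F (-x) = F y + F (-y) := by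
  obtain ⟨p, q, rfl, rfl⟩ : ∃ p q : X, x = p + q ∧ y = p + -q :=
    ⟨(2 : ℝ)⁻¹ • (x + y), (2 : ℝ)⁻¹ • (x - y), by module, by module⟩
  have hpq : ⟪p, q⟫ = 0 := by
    have h := (real_inner_add_sub_eq_zero_iff (p + q) (p + -q)).2 hxy
    rw [show p + q + (p + -q) = (2 : ℝ) • p by module,
      show p + q - (p + -q) = (2 : ℝ) • q by module, real_inner_smul_left,
      real_inner_smul_right] at h
    linarith
  have hy : ‖p + -q‖ < ρ := hxy ▸ hx
  rw [neg_add, neg_add, hF.map_add_of_norm_lt hpq hx,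
    hF.map_add_of_norm_lt (by simpa using hpq) hy,
    hF.map_add_of_norm_lt (by simpa using hpq) (by rwa [← neg_add, norm_neg]),
    hF.map_add_of_norm_lt (by simpa using hpq) (by rwa [← neg_add, norm_neg]), neg_neg]
  abel

theorem eqOn_halvingExtension (hdim : 2 ≤ Module.rank ℝ X)
    (hF : OrthogonallyAdditiveOn F (ball 0 ρ)) : EqOn (halvingExtension F) F (ball 0 ρ) := by
  intro x hx
  obtain ⟨y, rfl⟩ : ∃ y : X, x = (2 : ℝ) • y := ⟨(2 : ℝ)⁻¹ • x, by module⟩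
  obtain ⟨w, hw, hwn⟩ := exists_inner_eq_zero_norm_eq hdim y (norm_nonneg y)
  have hsum : (y + w) + (y + -w) = (2 : ℝ) • y := by module
  have horth : ⟪y + w, y + -w⟫ = 0 := by
    rw [← sub_eq_add_neg, real_inner_add_sub_eq_zero_iff, hwn]
  rw [mem_ball_zero_iff, ← hsum] at hx
  have hadd : ‖y + w‖ < ρ := (norm_left_le_norm_add_of_inner_eq_zero horth).trans_lt hx
  have hsub : ‖y + -w‖ < ρ := (norm_right_le_norm_add_of_inner_eq_zero horth).trans_lt hx
  have hy : ‖y‖ < ρ := (norm_left_le_norm_add_of_inner_eq_zero hw).trans_lt hadd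
  calc halvingExtension F ((2 : ℝ) • y) = F y + F y + (F y + F (-y)) := by
        rw [halvingExtension, inv_smul_smul₀ two_ne_zero]
        abel
    _ = (F y + F w) + (F y + F (-w)) := by
        rw [hF.map_add_map_neg_eq_of_norm_eq hy hwn.symm]
        abel
    _ = F ((2 : ℝ) • y) := by
        rw [← hF.map_add_of_norm_lt hw hadd, ← hF.map_add_of_norm_lt (by simpa using hw) hsub,
          ← hF.map_add_of_norm_lt horth hx, hsum]

theorem orthogonallyAdditiveOn_halvingExtension (hF : OrthogonallyAdditiveOn F (ball 0 ρ)) :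
    OrthogonallyAdditiveOn (halvingExtension F) (ball 0 (2 * ρ)) := by
  intro x _ y _ hadd hxy
  have horth : ⟪(2 : ℝ)⁻¹ • x, (2 : ℝ)⁻¹ • y⟫ = 0 := by
    rw [real_inner_smul_left, real_inner_smul_right, hxy, mul_zero, mul_zero]
  have hlt : ‖(2 : ℝ)⁻¹ • x + (2 : ℝ)⁻¹ • y‖ < ρ := by
    rw [mem_ball_zero_iff] at hadd
    rw [← smul_add, norm_smul, Real.norm_of_nonneg (by positivity)]
    linarith
  have hneg := hF.map_add_of_norm_lt (by rwa [inner_neg_neg]) (by rwa [← neg_add, norm_neg])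
  simp only [halvingExtension, smul_add, neg_add, hF.map_add_of_norm_lt horth hlt, hneg]
  abel

theorem exists_orthogonallyAdditive_eqOn_ball (hdim : 2 ≤ Module.rank ℝ X) (hρ : 0 < ρ)
    (hF : OrthogonallyAdditiveOn F (ball 0 ρ)) :
    ∃ G : X → Y, OrthogonallyAdditive G ∧ EqOn G F (ball 0 ρ) := by
  have iterate_additive : ∀ n, OrthogonallyAdditiveOn (halvingExtension^[n] F)
      (ball 0 (2 ^ n * ρ)) := by
    intro n
    induction n with
    | zero => simpa using hF
    | succ n ih =>
      rw [iterate_succ_apply', pow_succ', mul_assoc]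
      exact ih.orthogonallyAdditiveOn_halvingExtension
  have exists_mem : ∀ x : X, ∃ n : ℕ, x ∈ ball 0 (2 ^ n * ρ) := by
    intro x
    obtain ⟨n, hn⟩ := pow_unbounded_of_one_lt (‖x‖ / ρ) one_lt_two
    exact ⟨n, mem_ball_zero_iff.2 ((div_lt_iff₀ hρ).1 hn)⟩
  obtain ⟨G, hG⟩ := exists_forall_eqOn_of_eqOn_succ
    (S := fun n : ℕ => ball (0 : X) (2 ^ n * ρ)) (F := fun n => halvingExtension^[n] F)
    (fun m n hmn => ball_subset_ball (by gcongr; exact one_le_two)) exists_mem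
    (fun n => by
      rw [iterate_succ_apply']
      exact (iterate_additive n).eqOn_halvingExtension hdim)
  refine ⟨G, fun x y hxy => ?_, by simpa using hG 0⟩
  obtain ⟨n, hn⟩ := exists_mem (x + y)
  have hx := norm_left_le_norm_add_of_inner_eq_zero hxy
  have hy := norm_right_le_norm_add_of_inner_eq_zero hxy
  rw [mem_ball_zero_iff] at hn
  rw [hG n (mem_ball_zero_iff.2 hn), hG n (mem_ball_zero_iff.2 (hx.trans_lt hn)),
    hG n (mem_ball_zero_iff.2 (hy.trans_lt hn)), (iterate_additive n).map_add_of_norm_lt hxy hn]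

theorem map_eq_map_inv_one_add_sq_smul {U : Set X} (hG : OrthogonallyAdditiveOn G S)
    (hS : StarConvex ℝ 0 S) (hU : StarConvex ℝ 0 U) (hUS : U ⊆ S) (hGU : EqOn G 0 U) {x w : X}
    {θ : ℝ} (hxw : ⟪x, w⟫ = 0) (hnorm : ‖w‖ = ‖x‖) (hx : x ∈ S) (hadd : x + θ • w ∈ S)
    (hw : θ • w ∈ U) (hsub : θ • (θ • x - w) ∈ U) : G x = G ((1 + θ ^ 2)⁻¹ • x) := by
  have hpos : 0 < 1 + θ ^ 2 := by positivity
  set a : ℝ := (1 + θ ^ 2)⁻¹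
  have haθ : a * (1 + θ ^ 2) = 1 := inv_mul_cancel₀ hpos.ne'
  have ha₀ : 0 ≤ a := inv_nonneg.2 hpos.le
  have ha₁ : a ≤ 1 := inv_le_one_of_one_le₀ (by nlinarith)
  -- The projection of `x` to the line through `x + θ • w`, and of that back to the line of `x`.
  have proj_x : a • (x + θ • w) + a • θ • (θ • x - w) = x := by
    calc _ = (a * (1 + θ ^ 2)) • x := by module
      _ = x := by rw [haθ, one_smul]
  have proj_back : a • x + a • θ • w = a • (x + θ • w) := by module
  have horth : ⟪a • (x + θ • w), a • θ • (θ • x - w)⟫ = 0 := by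
    simp only [inner_add_left, inner_sub_right, real_inner_smul_left, real_inner_smul_right, hxw,
      real_inner_comm x w, real_inner_self_eq_norm_sq, hnorm]
    ring
  have hsub' : a • θ • (θ • x - w) ∈ U := hU.smul_mem hsub ha₀ ha₁
  have hw' : a • θ • w ∈ U := hU.smul_mem hw ha₀ ha₁
  have hadd' : a • (x + θ • w) ∈ S := hS.smul_mem hadd ha₀ ha₁
  calc G x = G (a • (x + θ • w)) := by
        nth_rw 1 [← proj_x]
        rw [hG hadd' (hUS hsub') (by rwa [proj_x]) horth, hGU hsub', Pi.zero_apply, add_zero]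
    _ = G (a • x) := by
        rw [← proj_back, hG (hS.smul_mem hx ha₀ ha₁) (hUS hw') (by rwa [proj_back])
          (by simp only [real_inner_smul_left, real_inner_smul_right, hxw, mul_zero]), hGU hw',
          Pi.zero_apply, add_zero]

theorem eqOn_zero_of_eventually (hdim : 2 ≤ Module.rank ℝ X) (hopen : IsOpen S)
    (hstar : StarConvex ℝ 0 S) (hG : OrthogonallyAdditiveOn G S) (hG₀ : ∀ᶠ x in 𝓝 0, G x = 0) :
    EqOn G 0 S := by
  intro x hx
  have h0 : S ∈ 𝓝 0 := hopen.mem_nhds (hstar.mem ⟨x, hx⟩)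
  obtain ⟨ρ, hρ, hball⟩ := Metric.eventually_nhds_iff_ball.1 (hG₀.and h0)
  have hU : StarConvex ℝ 0 (ball (0 : X) ρ) := (convex_ball 0 ρ).starConvex (mem_ball_self hρ)
  obtain ⟨w, hxw, hnorm⟩ := exists_inner_eq_zero_norm_eq hdim x (norm_nonneg x)
  obtain ⟨θ, hθ, hadd, hw, hsub⟩ :=
    exists_pos_add_smul_mem x w (hopen.mem_nhds hx) (ball_mem_nhds 0 hρ)
  have ha₀ : 0 ≤ (1 + θ ^ 2)⁻¹ := by positivity
  have ha₁ : (1 + θ ^ 2)⁻¹ < 1 := inv_lt_one_of_one_lt₀ (by nlinarith)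
  refine of_eventually_nhds_zero_of_smul (P := fun y => G y = 0) ha₀ ha₁ hG₀ fun n h => ?_
  set k : ℝ := (1 + θ ^ 2)⁻¹ ^ n
  have hk₀ : 0 ≤ k := by positivity
  have hk₁ : k ≤ 1 := pow_le_one₀ ha₀ ha₁.le
  rw [pow_succ', mul_smul] at h
  rw [← h]
  refine hG.map_eq_map_inv_one_add_sq_smul hstar hU (fun y hy => (hball y hy).2)
    (fun y hy => (hball y hy).1) (w := k • w) ?_ ?_ (hstar.smul_mem hx hk₀ hk₁) ?_ ?_ ?_
  · rw [real_inner_smul_left, real_inner_smul_right, hxw, mul_zero, mul_zero]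
  · rw [norm_smul, norm_smul, hnorm]
  · convert hstar.smul_mem hadd hk₀ hk₁ using 1
    module
  · rw [smul_comm]
    exact hU.smul_mem hw hk₀ hk₁
  · convert hU.smul_mem hsub hk₀ hk₁ using 1
    module

theorem exists_orthogonallyAdditive_eqOn (hdim : 2 ≤ Module.rank ℝ X) (hopen : IsOpen S)
    (hstar : StarConvex ℝ 0 S) (h0 : (0 : X) ∈ S) (hF : OrthogonallyAdditiveOn F S) :
    ∃ G : X → Y, OrthogonallyAdditive G ∧ EqOn F G S := by
  obtain ⟨ρ, hρ, hball⟩ := Metric.isOpen_iff.1 hopen 0 h0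
  obtain ⟨G, hG, hGF⟩ := (hF.mono hball).exists_orthogonallyAdditive_eqOn_ball hdim hρ
  refine ⟨G, hG, fun x hx => sub_eq_zero.1 ?_⟩
  refine (hF.sub (hG.orthogonallyAdditiveOn S)).eqOn_zero_of_eventually hdim hopen hstar ?_ hx
  filter_upwards [ball_mem_nhds 0 hρ] with y hy
  rw [Pi.sub_apply, hGF hy, sub_self]

end OrthogonallyAdditiveOn

end OrthogonallyAdditive

/-- `F` respects scaling by the ratio `s / r` between points of `B`, stated without division. -/
def RatioHomogeneousOn {X Y : Type*} [AddMonoid X] [AddMonoid Y] (r s : ℕ) (F : X → Y)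
    (B : Set X) : Prop :=
  ∀ ⦃x⦄, x ∈ B → ∀ ⦃z⦄, z ∈ B → r • z = s • x → r • F z = s • F x

theorem RatioHomogeneousOn.symm {X Y : Type*} [AddMonoid X] [AddMonoid Y] {r s : ℕ} {F : X → Y}
    {B : Set X} (hF : RatioHomogeneousOn r s F B) : RatioHomogeneousOn s r F B :=
  fun _ hx _ hz hzx => (hF hz hx hzx.symm).symm

section RatioHomogeneousOn

variable {X Y : Type*} [NormedAddCommGroup X] [InnerProductSpace ℝ X] [AddCommGroup Y]
  [IsAddTorsionFree Y] {r s : ℕ} {B : Set X} {F : X → Y} {T : X →+ Y} {b : ℝ≥0 →+ Y}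

theorem map_nnnorm_sq_eq_zero_of_nsmul_eq (hs : 0 < s) (hsr : s ≠ r) {x z : X}
    (hz : r • z = s • x) (h : r • b (‖z‖₊ ^ 2) = s • b (‖x‖₊ ^ 2)) : b (‖x‖₊ ^ 2) = 0 := by
  have hnorm : (r * r) • ‖z‖₊ ^ 2 = (s * s) • ‖x‖₊ ^ 2 := by
    have hnorm_eq : (r : ℝ≥0) * ‖z‖₊ = s * ‖x‖₊ := by
      simpa only [RCLike.nnnorm_nsmul ℝ, nsmul_eq_mul] using congr_arg (‖·‖₊) hz
    rw [nsmul_eq_mul, nsmul_eq_mul, Nat.cast_mul, Nat.cast_mul, sq, sq, mul_mul_mul_comm, hnorm_eq,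
      mul_mul_mul_comm]
  have hscale : (s * r) • b (‖x‖₊ ^ 2) = (s * s) • b (‖x‖₊ ^ 2) := by
    rw [← map_nsmul b (s * s), ← hnorm, map_nsmul, mul_smul r r, h, ← mul_smul, mul_comm]
  by_contra hne
  have hcancel : ((s * r : ℕ) : ℤ) = (s * s : ℕ) :=
    smul_left_injective ℤ hne (by simpa only [natCast_zsmul] using hscale)
  exact hsr.symm (Nat.eq_of_mul_eq_mul_left hs (Int.ofNat.inj hcancel))

namespace RatioHomogeneousOn

theorem eventually_eq_addMonoidHom (hr : 0 < r) (hs : 0 < s) (hsr : s ≠ r) (hB : B ∈ 𝓝 0)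
    (hF : RatioHomogeneousOn r s F B) (hTb : ∀ᶠ x in 𝓝 0, F x = T x + b (‖x‖₊ ^ 2)) :
    ∀ᶠ x in 𝓝 0, F x = T x := by
  have htendsto : Tendsto (fun x : X => ((s : ℝ) / r) • x) (𝓝 0) (𝓝 0) :=
    (continuous_const_smul _).tendsto' 0 0 (smul_zero _)
  filter_upwards [hTb, hB, htendsto.eventually hTb, htendsto.eventually hB] with x hx hxB hz hzB
  have hzx : r • ((s : ℝ) / r) • x = s • x := nsmul_natCast_div_smul s hr x
  have hFzx := hF hxB hzB hzx
  rw [hx, hz, smul_add, smul_add, ← map_nsmul T, ← map_nsmul T, hzx, add_right_inj] at hFzx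
  rw [hx, map_nnnorm_sq_eq_zero_of_nsmul_eq hs hsr hzx hFzx, add_zero]

theorem eqOn_addMonoidHom (hr : 0 < r) (hs : 0 < s) (hsr : s ≠ r) (hB : StarConvex ℝ 0 B)
    (hF : RatioHomogeneousOn r s F B) (hT : ∀ᶠ x in 𝓝 0, F x = T x) : EqOn F T B := by
  intro x hx
  wlog hlt : s < r generalizing r s
  · exact this hs hr hsr.symm hF.symm (hsr.symm.lt_of_le (not_lt.1 hlt))
  have ha₀ : 0 ≤ (s : ℝ) / r := by positivity
  have ha₁ : (s : ℝ) / r < 1 := (div_lt_one (by positivity)).2 (by exact_mod_cast hlt)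
  have hmem : ∀ n : ℕ, ((s : ℝ) / r) ^ n • x ∈ B := fun n =>
    hB.smul_mem hx (by positivity) (pow_le_one₀ ha₀ ha₁.le)
  refine of_eventually_nhds_zero_of_smul ha₀ ha₁ hT fun n hn => ?_
  have hscale : r • ((s : ℝ) / r) ^ (n + 1) • x = s • ((s : ℝ) / r) ^ n • x := by
    rw [pow_succ', mul_smul, nsmul_natCast_div_smul s hr]
  refine nsmul_right_injective hs.ne' ?_
  dsimp only
  rw [← hF (hmem n) (hmem (n + 1)) hscale, hn, ← map_nsmul, hscale, map_nsmul]

end RatioHomogeneousOn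

end RatioHomogeneousOn

/-- The orthogonally generalized Jensen equation for a map `F` defined on the whole space, with the
point `z = (s x + t y) / r` described by `r z = s x + t y`, so that the equation makes sense for
values in an abelian group. -/
def OrthogonallyJensenOn {X Y : Type*} [NormedAddCommGroup X] [InnerProductSpace ℝ X]
    [AddCommGroup Y] (r s t : ℕ) (F : X → Y) (B : Set X) : Prop :=
  ∀ ⦃x⦄, x ∈ B → ∀ ⦃y⦄, y ∈ B → ∀ ⦃z⦄, z ∈ B → ⟪x, y⟫ = 0 → r • z = s • x + t • y →
    r • F z = s • F x + t • F y

namespace OrthogonallyJensenOn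

section AddCommGroup

variable {X Y : Type*} [NormedAddCommGroup X] [InnerProductSpace ℝ X] [AddCommGroup Y]
  {r s t : ℕ} {B : Set X} {F : X → Y}

theorem symm (hF : OrthogonallyJensenOn r s t F B) : OrthogonallyJensenOn r t s F B := by
  intro x hx y hy z hz hxy hzxy
  rw [add_comm, hF hy hx hz (by rwa [real_inner_comm]) (by rwa [add_comm])]

theorem ratioHomogeneousOn (h0 : (0 : X) ∈ B) (hF₀ : F 0 = 0)
    (hF : OrthogonallyJensenOn r s t F B) : RatioHomogeneousOn r s F B := by
  intro x hx z hz hzx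
  simpa [hF₀] using hF hx h0 hz (inner_zero_right x) (by simpa using hzx)

variable [IsAddTorsionFree Y]

theorem orthogonallyAdditiveOn (hr : 0 < r) (hs : 0 < s) (ht : 0 < t) (h0 : (0 : X) ∈ B)
    (hF₀ : F 0 = 0) (hF : OrthogonallyJensenOn r s t F B) :
    OrthogonallyAdditiveOn F {x | x ∈ B ∧ ((r : ℝ) / s) • x ∈ B ∧ ((r : ℝ) / t) • x ∈ B} := by
  rintro x ⟨hx, hxs, -⟩ y ⟨hy, -, hyt⟩ ⟨hxy, -, -⟩ horth
  have hsx : s • ((r : ℝ) / s) • x = r • x := nsmul_natCast_div_smul r hs x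
  have hty : t • ((r : ℝ) / t) • y = r • y := nsmul_natCast_div_smul r ht y
  refine nsmul_right_injective hr.ne' ?_
  calc r • F (x + y) = s • F (((r : ℝ) / s) • x) + t • F (((r : ℝ) / t) • y) :=
        hF hxs hyt hxy (by rw [real_inner_smul_left, real_inner_smul_right, horth]; simp)
          (by rw [hsx, hty, smul_add])
    _ = r • F x + r • F y := by
        rw [hF.ratioHomogeneousOn h0 hF₀ hxs hx hsx.symm,
          hF.symm.ratioHomogeneousOn h0 hF₀ hyt hy hty.symm]
    _ = r • (F x + F y) := (smul_add _ _ _).symm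

theorem exists_addMonoidHom_eventually_eq (hdim : 2 ≤ Module.rank ℝ X) (hr : 0 < r) (hs : 0 < s)
    (ht : 0 < t) (hB : B ∈ 𝓝 0) (hF₀ : F 0 = 0) (hF : OrthogonallyJensenOn r s t F B) :
    ∃ (T : X →+ Y) (b : ℝ≥0 →+ Y), ∀ᶠ x in 𝓝 0, F x = T x + b (‖x‖₊ ^ 2) := by
  have eventually_smul_mem : ∀ a : ℝ, ∀ᶠ x : X in 𝓝 0, a • x ∈ B := fun a =>
    ((continuous_const_smul a).tendsto' 0 0 (smul_zero a)).eventually hB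
  obtain ⟨ρ, hρ, hball⟩ := Metric.mem_nhds_iff.1
    (inter_mem hB (inter_mem (eventually_smul_mem (r / s)) (eventually_smul_mem (r / t))))
  obtain ⟨G, hG, hGF⟩ := ((hF.orthogonallyAdditiveOn hr hs ht (mem_of_mem_nhds hB) hF₀).mono
    hball).exists_orthogonallyAdditive_eqOn_ball hdim hρ
  obtain ⟨T, b, hTb⟩ := hG.exists_addMonoidHom hdim
  refine ⟨T, b, ?_⟩
  filter_upwards [ball_mem_nhds 0 hρ] with x hx
  rw [← hTb, hGF hx]

theorem exists_addMonoidHom_eqOn_of_ne (hdim : 2 ≤ Module.rank ℝ X) (hr : 0 < r) (hs : 0 < s)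
    (ht : 0 < t) (hsr : s ≠ r) (hopen : IsOpen B) (hstar : StarConvex ℝ 0 B) (h0 : (0 : X) ∈ B)
    (hF₀ : F 0 = 0) (hF : OrthogonallyJensenOn r s t F B) : ∃ T : X →+ Y, EqOn F T B := by
  have hB : B ∈ 𝓝 0 := hopen.mem_nhds h0
  have hhom := hF.ratioHomogeneousOn h0 hF₀
  obtain ⟨T, b, hTb⟩ := hF.exists_addMonoidHom_eventually_eq hdim hr hs ht hB hF₀
  exact ⟨T, hhom.eqOn_addMonoidHom hr hs hsr hstar
    (hhom.eventually_eq_addMonoidHom hr hs hsr hB hTb)⟩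

end AddCommGroup

end OrthogonallyJensenOn

theorem IsOrthogonallyGeneralizedJensen.extend {X Y : Type*} [NormedAddCommGroup X]
    [InnerProductSpace ℝ X] [AddCommGroup Y] [Module ℝ Y] {r s t : ℕ} {B : Set X} {f : B → Y}
    (hr : 0 < r) (hf : IsOrthogonallyGeneralizedJensen r s t B f) :
    OrthogonallyJensenOn r s t (Function.extend Subtype.val f 0) B := by
  intro x hx y hy z hz hxy hzxy
  have hz' : z = (r : ℝ)⁻¹ • ((s : ℝ) • x + (t : ℝ) • y) := by
    rw [eq_inv_smul_iff₀ (by positivity)]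
    simpa only [Nat.cast_smul_eq_nsmul] using hzxy
  have := hf ⟨x, hx⟩ ⟨y, hy⟩ ⟨z, hz⟩ hxy hz'
  simpa only [Nat.cast_smul_eq_nsmul, ← Subtype.val_injective.extend_apply f 0] using this

theorem theorem6p1_general {X Y : Type*} [NormedAddCommGroup X] [InnerProductSpace ℝ X]
    (hdim : 2 ≤ Module.rank ℝ X) [AddCommGroup Y] [IsAddTorsionFree Y] {r s t : ℕ} (hr : 0 < r)
    (hs : 0 < s) (ht : 0 < t) {B : Set X} (hopen : IsOpen B) (hstar : StarConvex ℝ 0 B)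
    (h0 : (0 : X) ∈ B) {F : X → Y} (hF₀ : F 0 = 0) (hF : OrthogonallyJensenOn r s t F B) :
    ∃ (T : X →+ Y) (b : ℝ≥0 →+ Y), ∀ x ∈ B, F x = T x + b (‖x‖₊ ^ 2) := by
  rcases ne_or_eq s r with hsr | rfl
  · obtain ⟨T, hT⟩ := hF.exists_addMonoidHom_eqOn_of_ne hdim hr hs ht hsr hopen hstar h0 hF₀
    exact ⟨T, 0, fun x hx => by simpa using hT hx⟩
  rcases ne_or_eq t s with hts | rfl
  · obtain ⟨T, hT⟩ := hF.symm.exists_addMonoidHom_eqOn_of_ne hdim hr ht hs hts hopen hstar h0 hF₀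
    exact ⟨T, 0, fun x hx => by simpa using hT hx⟩
  have hadd : OrthogonallyAdditiveOn F B := by
    simpa [hr.ne'] using hF.orthogonallyAdditiveOn hr hs ht h0 hF₀
  obtain ⟨G, hG, hFG⟩ := hadd.exists_orthogonallyAdditive_eqOn hdim hopen hstar h0
  obtain ⟨T, b, hTb⟩ := hG.exists_addMonoidHom hdim
  exact ⟨T, b, fun x hx => by rw [hFG hx, hTb]⟩

theorem theorem6p1 {X Y : Type*} [NormedAddCommGroup X] [InnerProductSpace ℝ X]
    (hdim : 2 ≤ Module.rank ℝ X)
    [AddCommGroup Y] [Module ℝ Y] [TopologicalSpace Y] [IsTopologicalAddGroup Y]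
    [ContinuousSMul ℝ Y] (hY : IsSequentiallyComplete Y)
    (r s t : ℕ) (hr : 0 < r) (hs : 0 < s) (ht : 0 < t)
    (c : X) (R : ℝ) (h0 : (0 : X) ∈ Metric.ball c R)
    (f : Metric.ball c R → Y) (hf0 : f ⟨0, h0⟩ = 0)
    (hf : IsOrthogonallyGeneralizedJensen r s t (Metric.ball c R) f) :
    ∃ (T : X →+ Y) (b : ℝ≥0 →+ Y),
      ∀ x : Metric.ball c R, f x = T (x : X) + b (‖(x : X)‖₊ ^ 2) := by
  have : IsAddTorsionFree Y := .of_isTorsionFree ℝ Y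
  have hext := Subtype.val_injective.extend_apply f 0
  obtain ⟨T, b, h⟩ := theorem6p1_general hdim hr hs ht Metric.isOpen_ball
    ((convex_ball c R).starConvex h0) h0 ((hext ⟨0, h0⟩).trans hf0) (hf.extend hr)
  exact ⟨T, b, fun x => by rw [← hext, h x x.2]⟩
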